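/- For $n\in\mathbb N$ and $1\le p<\infty$ put $\|x\|_p=\big(\sum_{i=1}^n|x_i|^p\big)^{1/p}$ for $x\in\mathbb R^n$, $\mathbb B_p^n=\{x\in\mathbb R^n:\|x\|_p\le 1\}$ and $\mathbb S_p^{n-1}=\{x\in\mathbb R^n:\|x\|_p=1\}$. The cone probability measure of $\mathbb B_p^n$ is the measure on the Borel subsets $B$ of $\mathbb S_p^{n-1}$ given by $$\mathbf m_{\mathbb B_p^n}(B)=\frac{\mathrm{vol}_n(\{rx:x\in B,\ 0\le r\le 1\})}{\mathrm{vol}_n(\mathbb B_p^n)}.$$ Let $\psi_2(x)=e^{x^2}-1$. For a probability space $(\Omega,\mathcal F,\mathbf P)$, the Orlicz space $L_{\psi_2}(\Omega,\mathbf P)$ consists of all measurable $f:\Omega\to\mathbb R$ (modulo almost everywhere equality) with $\int_\Omega\psi_2(|f|/\lambda)\,d\mathbf P<\infty$ for some $\lambda>0$, and it carries the Luxemburg norm $$\|f\|_{\psi_2}=\inf\Big\{\lambda>0:\int_\Omega\psi_2\Big(\frac{|f|}{\lambda}\Big)\,d\mathbf P\le 1\Big\}.$$ Proposition. There exists an absolute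 constant $c_{\psi_2}\in(0,\infty)$ such that for all real $p$ with $2\le p<\infty$, all $n\in\mathbb N$ and all $\theta\in\mathbb R^n$ with $\|\theta\|_2=1$, the function $x\mapsto n^{1/p}\langle x,\theta\rangle$ on $\mathbb S_p^{n-1}$ belongs to $L_{\psi_2}(\mathbb S_p^{n-1},\mathbf m_{\mathbb B_p^n})$ and $$\big\|n^{1/p}\langle\,\cdot\,,\theta\rangle\big\|_{\psi_2}\le c_{\psi_2},$$ where $\|\cdot\|_{\psi_2}$ is the norm of $L_{\psi_2}(\mathbb S_p^{n-1},\mathbf m_{\mathbb B_p^n})$ and $\langle\cdot,\cdot\rangle$ is the standard scalar product. -/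

import Mathlib

open MeasureTheory Set
open scoped ENNReal

/-- The `ℓ_p` norm `‖x‖_p = (∑ i, |x i| ^ p) ^ (1 / p)` on `ℝⁿ`. -/
noncomputable def ellpNorm {n : ℕ} (p : ℝ) (x : EuclideanSpace ℝ (Fin n)) : ℝ :=
  (∑ i, |x i| ^ p) ^ (1 / p)

/-- The unit ball `B_p^n` of `ℓ_p^n`. -/
def lpBall (n : ℕ) (p : ℝ) : Set (EuclideanSpace ℝ (Fin n)) := {x | ellpNorm p x ≤ 1}

/-- The unit sphere `S_p^{n-1}` of `ℓ_p^n`; as a type it carries the Borel σ-algebra. -/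
def lpSphere (n : ℕ) (p : ℝ) : Set (EuclideanSpace ℝ (Fin n)) := {x | ellpNorm p x = 1}

/-- The cone `{r x : x ∈ B, 0 ≤ r ≤ 1}` over `B` with apex at the origin. -/
def coneOver {n : ℕ} (B : Set (EuclideanSpace ℝ (Fin n))) : Set (EuclideanSpace ℝ (Fin n)) :=
  {y | ∃ x ∈ B, ∃ r : ℝ, 0 ≤ r ∧ r ≤ 1 ∧ y = r • x}

theorem ellpNorm_smul {n : ℕ} {p : ℝ} (hp : 1 ≤ p) {r : ℝ} (hr : 0 ≤ r)
    (x : EuclideanSpace ℝ (Fin n)) : ellpNorm p (r • x) = r * ellpNorm p x := by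
  have hp0 : p ≠ 0 := by linarith
  have hs : 0 ≤ ∑ i, |x i| ^ p := Finset.sum_nonneg fun i _ => by positivity
  simp only [ellpNorm, PiLp.smul_apply, smul_eq_mul, abs_mul, abs_of_nonneg hr,
    Real.mul_rpow hr (abs_nonneg _), ← Finset.mul_sum]
  rw [Real.mul_rpow (by positivity) hs, ← Real.rpow_mul hr, mul_one_div_cancel hp0, Real.rpow_one]

theorem measurable_ellpNorm (n : ℕ) (p : ℝ) :
    Measurable (ellpNorm p : EuclideanSpace ℝ (Fin n) → ℝ) := by
  unfold ellpNorm
  fun_prop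

theorem measurableSet_lpSphere (n : ℕ) (p : ℝ) : MeasurableSet (lpSphere n p) :=
  measurable_ellpNorm n p (measurableSet_singleton 1)

/-- The cone over `B` without its apex, in polar form. -/
def puncturedCone {n : ℕ} {p : ℝ} (B : Set (lpSphere n p)) : Set (EuclideanSpace ℝ (Fin n)) :=
  {y | ellpNorm p y ≤ 1 ∧ (ellpNorm p y)⁻¹ • y ∈ ((↑) '' B : Set (EuclideanSpace ℝ (Fin n)))}

theorem measurableSet_puncturedCone {n : ℕ} {p : ℝ} {B : Set (lpSphere n p)}
    (hB : MeasurableSet B) : MeasurableSet (puncturedCone B) := by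
  have h := measurable_ellpNorm n p
  exact (measurableSet_le h measurable_const).inter
    ((h.inv.smul measurable_id) ((measurableSet_lpSphere n p).subtype_image hB))

theorem zero_notMem_lpSphere {n : ℕ} {p : ℝ} (hp : 1 ≤ p) : 0 ∉ lpSphere n p := by
  have h := ellpNorm_smul hp le_rfl (0 : EuclideanSpace ℝ (Fin n))
  simp only [zero_smul, zero_mul] at h
  simp [lpSphere, h]

theorem volume_coneOver {n : ℕ} {p : ℝ} (hp : 1 ≤ p) (B : Set (lpSphere n p)) :
    volume (coneOver ((↑) '' B : Set (EuclideanSpace ℝ (Fin n)))) = volume (puncturedCone B) := by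
  rcases B.eq_empty_or_nonempty with rfl | ⟨b, -⟩
  · simp [coneOver, puncturedCone]
  have : Nontrivial (EuclideanSpace ℝ (Fin n)) :=
    ⟨b, 0, fun h => zero_notMem_lpSphere hp (h ▸ b.2)⟩
  have h0 : volume ({0} : Set (EuclideanSpace ℝ (Fin n))) = 0 := measure_singleton 0
  apply le_antisymm
  · have hsub : coneOver ((↑) '' B : Set (EuclideanSpace ℝ (Fin n))) ⊆
        puncturedCone B ∪ {0} := by
      rintro _ ⟨x, hx, r, hr0, hr1, rfl⟩
      rcases hr0.eq_or_lt with rfl | hr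
      · simp
      left
      have hx1 : ellpNorm p x = 1 := by
        obtain ⟨y, -, rfl⟩ := hx
        exact y.2
      have h1 : ellpNorm p (r • x) = r := by rw [ellpNorm_smul hp hr0, hx1, mul_one]
      refine ⟨by rw [h1]; exact hr1, ?_⟩
      rw [h1, smul_smul, inv_mul_cancel₀ hr.ne', one_smul]
      exact hx
    calc _ ≤ volume (puncturedCone B ∪ {0}) := measure_mono hsub
      _ ≤ volume (puncturedCone B) + volume {0} := measure_union_le _ _
      _ = _ := by rw [h0, add_zero]
  · refine measure_mono fun y hy => ?_
    obtain ⟨hy1, hy2⟩ := hy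
    have hne : ellpNorm p y ≠ 0 := by
      intro h
      rw [h, inv_zero, zero_smul] at hy2
      obtain ⟨z, -, hz⟩ := hy2
      exact zero_notMem_lpSphere hp (hz ▸ z.2)
    refine ⟨_, hy2, ellpNorm p y, ?_, hy1, ?_⟩
    · exact Real.rpow_nonneg (Finset.sum_nonneg fun i _ => by positivity) _
    · rw [smul_smul, mul_inv_cancel₀ hne, one_smul]

/-- The cone probability measure of `B_p^n` on the Borel subsets of `S_p^{n-1}`:
`B ↦ vol {r x : x ∈ B, 0 ≤ r ≤ 1} / vol B_p^n`. -/
noncomputable def coneMeasure (n : ℕ) (p : ℝ) (hp : 1 ≤ p) : Measure (lpSphere n p) :=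
  Measure.ofMeasurable
    (fun B _ => volume (coneOver ((↑) '' B : Set (EuclideanSpace ℝ (Fin n)))) /
      volume (lpBall n p))
    (by simp [coneOver])
    (by
      intro f hf hd
      have hunion : puncturedCone (⋃ i, f i) = ⋃ i, puncturedCone (f i) := by
        ext y
        simp only [puncturedCone, image_iUnion, mem_iUnion, mem_ofPred_eq, exists_and_left]
      have hdisj : Pairwise (Function.onFun Disjoint fun i => puncturedCone (f i)) := by
        intro i j hij
        refine Set.disjoint_left.2 fun y hi hj => ?_
        obtain ⟨a, ha, hay⟩ := hi.2
        obtain ⟨b, hb, hby⟩ := hj.2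
        have hab : a = b := Subtype.ext (hay.trans hby.symm)
        exact Set.disjoint_left.1 (hd hij) ha (hab ▸ hb)
      simp only [volume_coneOver hp]
      rw [hunion, measure_iUnion hdisj fun i => measurableSet_puncturedCone (hf i)]
      simp only [div_eq_mul_inv, ENNReal.tsum_mul_right])

/-- Membership of `f` in the Orlicz space `L_M(Ω, P)` of an Orlicz function `M`. -/
def MemOrlicz {Ω : Type*} [MeasurableSpace Ω] (M : ℝ → ℝ) (f : Ω → ℝ) (P : Measure Ω) : Prop :=
  AEMeasurable f P ∧ ∃ l : ℝ, 0 < l ∧ ∫⁻ x, ENNReal.ofReal (M (|f x| / l)) ∂P < ∞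

/-- The Luxemburg norm `inf {l > 0 : ∫ M (|f| / l) dP ≤ 1}`, with values in `[0, ∞]`
(the infimum of the empty set is `∞`). -/
noncomputable def luxemburgNorm {Ω : Type*} [MeasurableSpace Ω] (M : ℝ → ℝ) (f : Ω → ℝ)
    (P : Measure Ω) : ℝ≥0∞ :=
  sInf {t | ∃ l : ℝ, 0 < l ∧ ∫⁻ x, ENNReal.ofReal (M (|f x| / l)) ∂P ≤ 1 ∧ t = ENNReal.ofReal l}

/-- The Orlicz function `ψ₂(x) = exp (x²) - 1`. -/
noncomputable def psiTwo (x : ℝ) : ℝ := Real.exp (x ^ 2) - 1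

/-! Under the density proportional to `exp (-‖x‖_p ^ p)` the coordinates are independent, while the
direction `x / ‖x‖_p` follows the cone measure and is independent of the radius `‖x‖_p`.
Sub-Gaussian bounds for the product density therefore pass to the sphere once the radius is known to
be large often enough.

For `p ≥ 2` each coordinate is sub-Gaussian uniformly in `p`
(`exists_lintegral_exp_mul_expNegAbsRpow_le`). Independence and `‖θ‖_2 = 1` make `⟨x, θ⟩`
sub-Gaussian with the same constant, and a Gaussian average yields a bounded moment of `exp (b ⟨x,
θ⟩²)` (`exists_lintegral_exp_inner_sq_le`).

At least half of the mass lies where `‖x‖_p ≥ a n^(1/p)`, with `a = 1/(2e)`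
(`lintegral_expNegSumRpow_le_two_mul`). There `n^(1/p) |⟨x, θ⟩| / ‖x‖_p ≤ |⟨x, θ⟩| / a`, so
independence (`volume_lpBall_mul_lintegral_mul_comp_ellpNorm`) bounds the spherical integral by
twice the moment on the product space. -/

/-! ### One-dimensional estimates, uniform in `p ≥ 2`. -/

/-- The unnormalized density `exp (-|t| ^ p)`. -/
noncomputable def expNegAbsRpow (p t : ℝ) : ℝ≥0∞ := ENNReal.ofReal (Real.exp (-|t| ^ p))

@[fun_prop]
theorem measurable_expNegAbsRpow (p : ℝ) : Measurable (expNegAbsRpow p) := by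
  unfold expNegAbsRpow
  fun_prop

/-- Source of the uniformity in `p`: the density is dominated by `e · exp (-t²)`. -/
theorem sq_sub_one_le_abs_rpow {p : ℝ} (hp : 2 ≤ p) (t : ℝ) : t ^ 2 - 1 ≤ |t| ^ p := by
  rcases le_total |t| 1 with h | h
  · have h1 : 0 ≤ |t| ^ p := by positivity
    have h2 : t ^ 2 ≤ 1 := (sq_le_one_iff_abs_le_one t).2 h
    linarith
  · have := Real.rpow_le_rpow_of_exponent_le h hp
    rw [Real.rpow_two, sq_abs] at this
    linarith

theorem lintegral_exp_neg_mul_sq_lt_top {b : ℝ} (hb : 0 < b) :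
    ∫⁻ t : ℝ, ENNReal.ofReal (Real.exp (-b * t ^ 2)) < ∞ := by
  rw [← ofReal_integral_eq_lintegral_ofReal (integrable_exp_neg_mul_sq hb)
    (ae_of_all _ fun t => (Real.exp_pos _).le)]
  exact ENNReal.ofReal_lt_top

theorem one_le_exp_mul_lintegral_expNegAbsRpow {p : ℝ} (hp : 0 ≤ p) :
    1 ≤ ENNReal.ofReal (Real.exp 1) * ∫⁻ t, expNegAbsRpow p t := by
  have h : ENNReal.ofReal (Real.exp (-1)) ≤ ∫⁻ t, expNegAbsRpow p t := by
    calc ENNReal.ofReal (Real.exp (-1))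
        = ∫⁻ _ in Icc (0 : ℝ) 1, ENNReal.ofReal (Real.exp (-1)) := by simp
      _ ≤ ∫⁻ t in Icc (0 : ℝ) 1, expNegAbsRpow p t := by
        refine setLIntegral_mono (measurable_expNegAbsRpow p) fun t ht => ?_
        refine ENNReal.ofReal_le_ofReal (Real.exp_le_exp.2 (neg_le_neg ?_))
        exact Real.rpow_le_one (abs_nonneg _) (by rw [abs_of_nonneg ht.1]; exact ht.2) hp
      _ ≤ _ := setLIntegral_le_lintegral _ _
  calc 1 = ENNReal.ofReal (Real.exp 1) * ENNReal.ofReal (Real.exp (-1)) := by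
        rw [← ENNReal.ofReal_mul (Real.exp_pos _).le, ← Real.exp_add]; simp
    _ ≤ _ := by gcongr

theorem exists_lintegral_exp_sq_expNegAbsRpow_le :
    ∃ K : ℝ, 0 ≤ K ∧ ∀ p : ℝ, 2 ≤ p →
      ∫⁻ t, ENNReal.ofReal (Real.exp (t ^ 2 / 2)) * expNegAbsRpow p t ≤
        ENNReal.ofReal K * ∫⁻ t, expNegAbsRpow p t := by
  set N := ∫⁻ t : ℝ, ENNReal.ofReal (Real.exp (-(1 / 2) * t ^ 2)) with hN
  have hN' : N < ∞ := lintegral_exp_neg_mul_sq_lt_top (by norm_num)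
  -- One factor `e` comes from the Gaussian domination, the other from the lower bound `1/e` on the
  -- total mass.
  refine ⟨Real.exp 1 * N.toReal * Real.exp 1, by positivity, fun p hp => ?_⟩
  calc _ ≤ ∫⁻ t : ℝ, ENNReal.ofReal (Real.exp 1) *
          ENNReal.ofReal (Real.exp (-(1 / 2) * t ^ 2)) := by
        refine lintegral_mono fun t => ?_
        simp only [expNegAbsRpow]
        rw [← ENNReal.ofReal_mul (Real.exp_pos _).le, ← ENNReal.ofReal_mul (Real.exp_pos _).le,
          ← Real.exp_add, ← Real.exp_add]
        refine ENNReal.ofReal_le_ofReal (Real.exp_le_exp.2 ?_)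
        linarith [sq_sub_one_le_abs_rpow hp t]
    _ = ENNReal.ofReal (Real.exp 1) * N * 1 := by
        rw [lintegral_const_mul _ (by fun_prop), mul_one]
    _ ≤ ENNReal.ofReal (Real.exp 1) * N *
          (ENNReal.ofReal (Real.exp 1) * ∫⁻ t, expNegAbsRpow p t) := by
        gcongr
        exact one_le_exp_mul_lintegral_expNegAbsRpow (by linarith)
    _ = _ := by
        rw [ENNReal.ofReal_mul (by positivity), ENNReal.ofReal_mul (by positivity),
          ENNReal.ofReal_toReal hN'.ne, mul_assoc, mul_assoc, mul_assoc]

theorem lintegral_expNegAbsRpow_lt_top {p : ℝ} (hp : 2 ≤ p) : ∫⁻ t, expNegAbsRpow p t < ∞ := by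
  calc _ ≤ ∫⁻ t : ℝ, ENNReal.ofReal (Real.exp 1) *
          ENNReal.ofReal (Real.exp (-1 * t ^ 2)) := by
        refine lintegral_mono fun t => ?_
        simp only [expNegAbsRpow]
        rw [← ENNReal.ofReal_mul (Real.exp_pos _).le, ← Real.exp_add]
        refine ENNReal.ofReal_le_ofReal (Real.exp_le_exp.2 ?_)
        linarith [sq_sub_one_le_abs_rpow hp t]
    _ < ∞ := by
        rw [lintegral_const_mul _ (by fun_prop)]
        exact ENNReal.mul_lt_top ENNReal.ofReal_lt_top (lintegral_exp_neg_mul_sq_lt_top one_pos)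

/-- The density is even. This removes the term linear in `u`, which would spoil a bound `exp (C u²)`
near `u = 0`. -/
theorem lintegral_exp_mul_expNegAbsRpow_eq_cosh (p u : ℝ) :
    ∫⁻ t, ENNReal.ofReal (Real.exp (u * t)) * expNegAbsRpow p t =
      ∫⁻ t, ENNReal.ofReal (Real.cosh (u * t)) * expNegAbsRpow p t := by
  have hneg : ∫⁻ t, ENNReal.ofReal (Real.exp (-(u * t))) * expNegAbsRpow p t =
      ∫⁻ t, ENNReal.ofReal (Real.exp (u * t)) * expNegAbsRpow p t := by
    rw [← lintegral_neg_eq_self]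
    simp [expNegAbsRpow]
  have h2 : 2 * ∫⁻ t, ENNReal.ofReal (Real.cosh (u * t)) * expNegAbsRpow p t =
      2 * ∫⁻ t, ENNReal.ofReal (Real.exp (u * t)) * expNegAbsRpow p t := by
    conv_rhs => rw [two_mul]; enter [2]; rw [← hneg]
    rw [← lintegral_add_left (by fun_prop), ← lintegral_const_mul _ (by fun_prop)]
    refine lintegral_congr fun t => ?_
    rw [← add_mul, ← ENNReal.ofReal_add (Real.exp_pos _).le (Real.exp_pos _).le, ← mul_assoc,
      show (2 : ℝ≥0∞) = ENNReal.ofReal 2 by simp, ← ENNReal.ofReal_mul zero_le_two, Real.cosh_eq]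
    congr 2
    ring
  exact ((ENNReal.mul_right_inj two_ne_zero (by simp)).1 h2).symm

/-- Convexity of `exp` between `0` and `s`. It is also what later makes the integral of `ψ₂` small
by enlarging the scale. -/
theorem exp_mul_sub_one_le {d s : ℝ} (h0 : 0 ≤ d) (h1 : d ≤ 1) :
    Real.exp (d * s) - 1 ≤ d * (Real.exp s - 1) := by
  have h := convexOn_exp.2 (mem_univ s) (mem_univ 0) h0 (sub_nonneg.2 h1) (by ring)
  simp only [smul_eq_mul, mul_zero, add_zero, Real.exp_zero, mul_one] at h
  linarith

/-- Uniform sub-Gaussian estimate for the densities `exp (-|t| ^ p)`, `p ≥ 2`. -/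
theorem exists_lintegral_exp_mul_expNegAbsRpow_le :
    ∃ C : ℝ, 0 < C ∧ ∀ p : ℝ, 2 ≤ p → ∀ u : ℝ,
      ∫⁻ t, ENNReal.ofReal (Real.exp (u * t)) * expNegAbsRpow p t ≤
        ENNReal.ofReal (Real.exp (C * u ^ 2)) * ∫⁻ t, expNegAbsRpow p t := by
  obtain ⟨K, hK, h⟩ := exists_lintegral_exp_sq_expNegAbsRpow_le
  refine ⟨K + 1 / 2, by positivity, fun p hp u => ?_⟩
  -- For small `u`, `cosh (ut) ≤ exp (u²t²/2) ≤ 1 + u² exp (t²/2)`. For large `u`, `ut ≤ u²/2 +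
  -- t²/2`, and the factor `K` is absorbed by `exp (K u²)`.
  rcases le_total (u ^ 2) 1 with hu | hu
  · rw [lintegral_exp_mul_expNegAbsRpow_eq_cosh]
    calc _ ≤ ∫⁻ t, (expNegAbsRpow p t +
          ENNReal.ofReal (u ^ 2) * (ENNReal.ofReal (Real.exp (t ^ 2 / 2)) * expNegAbsRpow p t)) := by
          refine lintegral_mono fun t => ?_
          rw [← mul_assoc, ← ENNReal.ofReal_mul (sq_nonneg u)]
          nth_rw 2 [← one_mul (expNegAbsRpow p t)]
          rw [← add_mul, ← ENNReal.ofReal_one, ← ENNReal.ofReal_add zero_le_one (by positivity)]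
          gcongr
          have h1 := Real.cosh_le_exp_half_sq (u * t)
          have h2 := exp_mul_sub_one_le (s := t ^ 2 / 2) (sq_nonneg u) hu
          rw [show (u * t) ^ 2 / 2 = u ^ 2 * (t ^ 2 / 2) by ring] at h1
          nlinarith [sq_nonneg u]
      _ ≤ (∫⁻ t, expNegAbsRpow p t) + ENNReal.ofReal (u ^ 2) *
            (ENNReal.ofReal K * ∫⁻ t, expNegAbsRpow p t) := by
          rw [lintegral_add_left (by fun_prop), lintegral_const_mul _ (by fun_prop)]
          gcongr
          exact h p hp
      _ = ENNReal.ofReal (1 + u ^ 2 * K) * ∫⁻ t, expNegAbsRpow p t := by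
          rw [ENNReal.ofReal_add zero_le_one (by positivity), ENNReal.ofReal_mul (by positivity),
            add_mul, ENNReal.ofReal_one, one_mul, mul_assoc]
      _ ≤ _ := by
          gcongr
          have := Real.add_one_le_exp ((K + 1 / 2) * u ^ 2)
          nlinarith [sq_nonneg u]
  · calc _ ≤ ∫⁻ t, ENNReal.ofReal (Real.exp (u ^ 2 / 2)) *
            (ENNReal.ofReal (Real.exp (t ^ 2 / 2)) * expNegAbsRpow p t) := by
          refine lintegral_mono fun t => ?_
          rw [← mul_assoc, ← ENNReal.ofReal_mul (Real.exp_pos _).le, ← Real.exp_add]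
          gcongr
          nlinarith [sq_nonneg (u - t)]
      _ ≤ ENNReal.ofReal (Real.exp (u ^ 2 / 2)) *
            (ENNReal.ofReal K * ∫⁻ t, expNegAbsRpow p t) := by
          rw [lintegral_const_mul _ (by fun_prop)]
          gcongr
          exact h p hp
      _ ≤ _ := by
          rw [← mul_assoc, ← ENNReal.ofReal_mul (by positivity)]
          gcongr
          rw [show (K + 1 / 2) * u ^ 2 = u ^ 2 / 2 + K * u ^ 2 by ring, Real.exp_add]
          gcongr
          have := Real.add_one_le_exp (K * u ^ 2)
          nlinarith

/-! ### Product densities and moments of linear forms. -/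

theorem lintegral_pi_prod_eq_prod {n : ℕ} {f : Fin n → ℝ → ℝ≥0∞} (hf : ∀ i, Measurable (f i)) :
    ∫⁻ x : Fin n → ℝ, ∏ i, f i (x i) = ∏ i, ∫⁻ t, f i t := by
  induction n with
  | zero => simp [volume_pi]
  | succ n ih =>
    have hm : Measurable fun x : Fin n → ℝ => ∏ i, f i.succ (x i) :=
      Finset.measurable_prod _ fun i _ => (hf i.succ).comp (measurable_pi_apply i)
    rw [← (volume_preserving_piFinSuccAbove (fun _ => ℝ) 0).symm.lintegral_comp_emb
      (MeasurableEquiv.measurableEmbedding _)]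
    simp only [Fin.prod_univ_succ, MeasurableEquiv.piFinSuccAbove_symm_apply,
      Fin.insertNthEquiv_zero, Fin.consEquiv_apply, Fin.cons_zero, Fin.cons_succ]
    rw [← ih fun i => hf i.succ]
    exact lintegral_prod_mul (hf 0).aemeasurable hm.aemeasurable

theorem lintegral_euclidean_prod_eq_prod {n : ℕ} {f : Fin n → ℝ → ℝ≥0∞}
    (hf : ∀ i, Measurable (f i)) :
    ∫⁻ x : EuclideanSpace ℝ (Fin n), ∏ i, f i (x i) = ∏ i, ∫⁻ t, f i t := by
  rw [← lintegral_pi_prod_eq_prod hf]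
  exact (PiLp.volume_preserving_ofLp (Fin n)).lintegral_comp_emb
    (MeasurableEquiv.toLp 2 (Fin n → ℝ)).symm.measurableEmbedding (fun x => ∏ i, f i (x i))

/-- The unnormalized product density `exp (-∑ i, |x i| ^ p)`. -/
noncomputable def expNegSumRpow {n : ℕ} (p : ℝ) (x : EuclideanSpace ℝ (Fin n)) : ℝ≥0∞ :=
  ∏ i, expNegAbsRpow p (x i)

@[fun_prop]
theorem measurable_expNegSumRpow {n : ℕ} (p : ℝ) :
    Measurable (expNegSumRpow p : EuclideanSpace ℝ (Fin n) → ℝ≥0∞) := by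
  unfold expNegSumRpow
  fun_prop

theorem lintegral_expNegSumRpow (n : ℕ) (p : ℝ) :
    ∫⁻ x : EuclideanSpace ℝ (Fin n), expNegSumRpow p x = (∫⁻ t, expNegAbsRpow p t) ^ n := by
  simp only [expNegSumRpow]
  rw [lintegral_euclidean_prod_eq_prod fun _ => measurable_expNegAbsRpow p]
  simp

/-- The integral factorizes over coordinates and the exponents `C u² θ_i²` add up to `C u²`, so no
dependence on `n` appears. -/
theorem exists_lintegral_exp_inner_le :
    ∃ C : ℝ, 0 < C ∧ ∀ p : ℝ, 2 ≤ p → ∀ (n : ℕ) (θ : EuclideanSpace ℝ (Fin n)), ‖θ‖ = 1 → ∀ u : ℝ,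
      ∫⁻ x : EuclideanSpace ℝ (Fin n), ENNReal.ofReal (Real.exp (u * inner ℝ x θ)) *
          expNegSumRpow p x ≤
        ENNReal.ofReal (Real.exp (C * u ^ 2)) *
          ∫⁻ x : EuclideanSpace ℝ (Fin n), expNegSumRpow p x := by
  obtain ⟨C, hC, h⟩ := exists_lintegral_exp_mul_expNegAbsRpow_le
  refine ⟨C, hC, fun p hp n θ hθ u => ?_⟩
  have hprod : ∀ x : EuclideanSpace ℝ (Fin n), ENNReal.ofReal (Real.exp (u * inner ℝ x θ)) *
      expNegSumRpow p x =
      ∏ i, ENNReal.ofReal (Real.exp (u * θ i * x i)) * expNegAbsRpow p (x i) := by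
    intro x
    rw [expNegSumRpow, Finset.prod_mul_distrib, ← ENNReal.ofReal_prod_of_nonneg
      fun i _ => (Real.exp_pos _).le, ← Real.exp_sum]
    simp [PiLp.inner_apply, Finset.mul_sum, mul_assoc]
  have hsum : ∑ i, θ i ^ 2 = 1 := by
    have := EuclideanSpace.norm_sq_eq θ
    simpa [hθ] using this.symm
  simp only [hprod]
  rw [lintegral_euclidean_prod_eq_prod
    (f := fun i t => ENNReal.ofReal (Real.exp (u * θ i * t)) * expNegAbsRpow p t)
    fun i => by fun_prop]
  calc _ ≤ ∏ i, ENNReal.ofReal (Real.exp (C * (u * θ i) ^ 2)) * ∫⁻ t, expNegAbsRpow p t :=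
        Finset.prod_le_prod' fun i _ => h p hp _
    _ = _ := by
        rw [Finset.prod_mul_distrib, ← ENNReal.ofReal_prod_of_nonneg
          fun i _ => (Real.exp_pos _).le, ← Real.exp_sum, lintegral_expNegSumRpow]
        simp only [mul_pow, ← mul_assoc, ← Finset.mul_sum, hsum]
        simp

theorem lintegral_exp_mul_sub_sq (s : ℝ) :
    ∫⁻ z : ℝ, ENNReal.ofReal (Real.exp (z * s - z ^ 2)) =
      ENNReal.ofReal (Real.exp (s ^ 2 / 4)) * ∫⁻ z : ℝ, ENNReal.ofReal (Real.exp (-1 * z ^ 2)) := by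
  rw [← lintegral_sub_right_eq_self (fun z : ℝ => ENNReal.ofReal (Real.exp (-1 * z ^ 2))) (s / 2),
    ← lintegral_const_mul _ (by fun_prop)]
  refine lintegral_congr fun z => ?_
  rw [← ENNReal.ofReal_mul (Real.exp_pos _).le, ← Real.exp_add]
  ring_nf

/-- Up to a constant, `exp (s²/4)` is the average of `exp (zs)` against `exp (-z²)`. Exchanging the
integrals reduces the claim to the exponential moment at each `z`. -/
theorem exists_lintegral_exp_inner_sq_le :
    ∃ b M : ℝ, 0 < b ∧ 0 < M ∧ ∀ p : ℝ, 2 ≤ p → ∀ (n : ℕ) (θ : EuclideanSpace ℝ (Fin n)), ‖θ‖ = 1 →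
      ∫⁻ x : EuclideanSpace ℝ (Fin n), ENNReal.ofReal (Real.exp (b * (inner ℝ x θ) ^ 2)) *
          expNegSumRpow p x ≤
        ENNReal.ofReal M * ∫⁻ x : EuclideanSpace ℝ (Fin n), expNegSumRpow p x := by
  obtain ⟨C, hC, h⟩ := exists_lintegral_exp_inner_le
  set I := ∫⁻ z : ℝ, ENNReal.ofReal (Real.exp (-1 * z ^ 2)) with hI
  set J := ∫⁻ z : ℝ, ENNReal.ofReal (Real.exp (-(1 / 2) * z ^ 2)) with hJ
  have hItop : I < ∞ := lintegral_exp_neg_mul_sq_lt_top one_pos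
  have hJtop : J < ∞ := lintegral_exp_neg_mul_sq_lt_top (by norm_num)
  have hI0 : I ≠ 0 := by
    intro h0
    rw [hI, lintegral_eq_zero_iff (by fun_prop)] at h0
    have : (volume : Measure ℝ) = 0 := by
      rw [← ae_eq_bot, ← Filter.eventually_false_iff_eq_bot]
      filter_upwards [h0] with z hz
      exact absurd hz (by simp [Real.exp_pos])
    exact NeZero.ne _ this
  -- With `C v² = 1/2` the moment bound consumes only half of the Gaussian exponent, leaving `exp
  -- (-z²/2)`.
  obtain ⟨v, hv0, hv⟩ : ∃ v : ℝ, 0 < v ∧ C * v ^ 2 = 1 / 2 := by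
    refine ⟨Real.sqrt (1 / (2 * C)), by positivity, ?_⟩
    rw [Real.sq_sqrt (by positivity)]
    field_simp
  -- The summand `1` only makes `M` visibly positive.
  refine ⟨v ^ 2 / 4, (J / I).toReal + 1, by positivity, by positivity, fun p hp n θ hθ => ?_⟩
  have hJI : J / I ≠ ∞ := ENNReal.div_ne_top hJtop.ne hI0
  set E := ∫⁻ x : EuclideanSpace ℝ (Fin n), expNegSumRpow p x with hE
  have key : I * ∫⁻ x : EuclideanSpace ℝ (Fin n),
      ENNReal.ofReal (Real.exp (v ^ 2 / 4 * (inner ℝ x θ) ^ 2)) * expNegSumRpow p x ≤ J * E := by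
    calc _ = ∫⁻ x : EuclideanSpace ℝ (Fin n), ∫⁻ z : ℝ,
          ENNReal.ofReal (Real.exp (z * (v * inner ℝ x θ) - z ^ 2)) * expNegSumRpow p x := by
          rw [← lintegral_const_mul _ (by fun_prop)]
          refine lintegral_congr fun x => ?_
          rw [lintegral_mul_const _ (by fun_prop), lintegral_exp_mul_sub_sq, ← mul_assoc,
            mul_comm I]
          congr 4
          ring
      _ = ∫⁻ z : ℝ, ∫⁻ x : EuclideanSpace ℝ (Fin n),
          ENNReal.ofReal (Real.exp (z * (v * inner ℝ x θ) - z ^ 2)) * expNegSumRpow p x :=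
          lintegral_lintegral_swap (by fun_prop)
      _ ≤ ∫⁻ z : ℝ, ENNReal.ofReal (Real.exp (-(1 / 2) * z ^ 2)) * E := by
          refine lintegral_mono fun z => ?_
          calc _ = ENNReal.ofReal (Real.exp (-z ^ 2)) * ∫⁻ x : EuclideanSpace ℝ (Fin n),
                ENNReal.ofReal (Real.exp ((z * v) * inner ℝ x θ)) * expNegSumRpow p x := by
                rw [← lintegral_const_mul _ (by fun_prop)]
                refine lintegral_congr fun x => ?_
                rw [← mul_assoc (ENNReal.ofReal _), ← ENNReal.ofReal_mul (Real.exp_pos _).le,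
                  ← Real.exp_add]
                ring_nf
            _ ≤ ENNReal.ofReal (Real.exp (-z ^ 2)) *
                (ENNReal.ofReal (Real.exp (C * (z * v) ^ 2)) * E) := by
                gcongr
                exact h p hp n θ hθ _
            _ = _ := by
                rw [← mul_assoc, ← ENNReal.ofReal_mul (Real.exp_pos _).le, ← Real.exp_add,
                  show -z ^ 2 + C * (z * v) ^ 2 = -(1 / 2) * z ^ 2 by
                    rw [mul_pow]; linear_combination z ^ 2 * hv]
      _ = J * E := lintegral_mul_const _ (by fun_prop)
  calc _ ≤ (J * E) / I := by
        rw [ENNReal.le_div_iff_mul_le (Or.inl hI0) (Or.inl hItop.ne), mul_comm]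
        exact key
    _ = (J / I) * E := by rw [div_eq_mul_inv, div_eq_mul_inv]; ring
    _ ≤ _ := by
        gcongr
        rw [ENNReal.ofReal_add ENNReal.toReal_nonneg zero_le_one, ENNReal.ofReal_toReal hJI]
        exact le_self_add

/-! ### The `ℓ_p` norm, scaling, and polar decomposition. -/

section Norm

variable {n : ℕ} {p : ℝ}

theorem sum_abs_rpow_nonneg (p : ℝ) (x : EuclideanSpace ℝ (Fin n)) : 0 ≤ ∑ i, |x i| ^ p :=
  Finset.sum_nonneg fun i _ => by positivity

theorem ellpNorm_nonneg (p : ℝ) (x : EuclideanSpace ℝ (Fin n)) : 0 ≤ ellpNorm p x :=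
  Real.rpow_nonneg (sum_abs_rpow_nonneg p x) _

theorem ellpNorm_rpow (hp : 1 ≤ p) (x : EuclideanSpace ℝ (Fin n)) :
    ellpNorm p x ^ p = ∑ i, |x i| ^ p := by
  rw [ellpNorm, ← Real.rpow_mul (sum_abs_rpow_nonneg p x), one_div_mul_cancel (by linarith),
    Real.rpow_one]

theorem expNegSumRpow_eq (hp : 1 ≤ p) (x : EuclideanSpace ℝ (Fin n)) :
    expNegSumRpow p x = ENNReal.ofReal (Real.exp (-ellpNorm p x ^ p)) := by
  simp only [expNegSumRpow, expNegAbsRpow]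
  rw [← ENNReal.ofReal_prod_of_nonneg fun i _ => (Real.exp_pos _).le, ← Real.exp_sum,
    ellpNorm_rpow hp, Finset.sum_neg_distrib]

theorem abs_apply_le_ellpNorm (hp : 1 ≤ p) (x : EuclideanSpace ℝ (Fin n)) (i : Fin n) :
    |x i| ≤ ellpNorm p x := by
  refine (Real.rpow_le_rpow_iff (abs_nonneg _) (ellpNorm_nonneg p x) (z := p) (by linarith)).1 ?_
  rw [ellpNorm_rpow hp]
  exact Finset.single_le_sum (f := fun i => |x i| ^ p) (fun i _ => by positivity)
    (Finset.mem_univ i)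

/-- A crude comparison: it serves only definiteness and finiteness, so the factor `n` never reaches
the final constant. -/
theorem norm_sq_le_mul_ellpNorm_sq (hp : 1 ≤ p) (x : EuclideanSpace ℝ (Fin n)) :
    ‖x‖ ^ 2 ≤ n * ellpNorm p x ^ 2 := by
  rw [EuclideanSpace.norm_sq_eq]
  calc _ ≤ ∑ _ : Fin n, ellpNorm p x ^ 2 := by
        refine Finset.sum_le_sum fun i _ => ?_
        rw [Real.norm_eq_abs]
        gcongr
        exact abs_apply_le_ellpNorm hp x i
    _ = _ := by simp

theorem eq_zero_of_ellpNorm_eq_zero (hp : 1 ≤ p) {x : EuclideanSpace ℝ (Fin n)}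
    (h : ellpNorm p x = 0) : x = 0 := by
  have := norm_sq_le_mul_ellpNorm_sq hp x
  rw [h] at this
  have h2 : ‖x‖ ^ 2 = 0 := le_antisymm (by simpa using this) (sq_nonneg _)
  simpa using h2

theorem measurableSet_lpBall (n : ℕ) (p : ℝ) : MeasurableSet (lpBall n p) :=
  measurableSet_le (measurable_ellpNorm n p) measurable_const

theorem volume_lpBall_lt_top (n : ℕ) (hp : 1 ≤ p) : volume (lpBall n p) < ∞ := by
  refine lt_of_le_of_lt (measure_mono (t := Metric.closedBall 0 (Real.sqrt n)) fun x hx => ?_)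
    measure_closedBall_lt_top
  rw [mem_closedBall_zero_iff]
  refine Real.le_sqrt_of_sq_le ((norm_sq_le_mul_ellpNorm_sq hp x).trans ?_)
  have : ellpNorm p x ^ 2 ≤ 1 := pow_le_one₀ (ellpNorm_nonneg p x) hx
  nlinarith [(Nat.cast_nonneg n : (0 : ℝ) ≤ n)]

theorem lintegral_eq_mul_lintegral_comp_smul {r : ℝ} (hr : 0 < r)
    {h : EuclideanSpace ℝ (Fin n) → ℝ≥0∞} (hh : Measurable h) :
    ∫⁻ x, h x = ENNReal.ofReal (r ^ n) * ∫⁻ x, h (r • x) := by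
  rw [← lintegral_map hh (measurable_const_smul r), Measure.map_addHaar_smul _ hr.ne',
    lintegral_smul_measure, finrank_euclideanSpace_fin, smul_eq_mul, ← mul_assoc,
    ← ENNReal.ofReal_mul (by positivity), abs_of_pos (by positivity),
    mul_inv_cancel₀ (by positivity), ENNReal.ofReal_one, one_mul]

theorem setLIntegral_sublevel_ellpNorm (hp : 1 ≤ p) {r : ℝ} (hr : 0 < r)
    {G : EuclideanSpace ℝ (Fin n) → ℝ≥0∞} (hG : Measurable G)
    (hGs : ∀ r : ℝ, 0 < r → ∀ x, G (r • x) = G x) :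
    ∫⁻ x in {x | ellpNorm p x ≤ r}, G x = ENNReal.ofReal (r ^ n) * ∫⁻ x in lpBall n p, G x := by
  have hm : MeasurableSet {x : EuclideanSpace ℝ (Fin n) | ellpNorm p x ≤ r} :=
    measurableSet_le (measurable_ellpNorm n p) measurable_const
  rw [← lintegral_indicator hm, ← lintegral_indicator (measurableSet_lpBall n p),
    lintegral_eq_mul_lintegral_comp_smul hr (hG.indicator hm)]
  congr 1
  refine lintegral_congr fun x => ?_
  have : ellpNorm p (r • x) ≤ r ↔ ellpNorm p x ≤ 1 := by
    rw [ellpNorm_smul hp hr.le, mul_le_iff_le_one_right hr]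
  simp only [indicator, lpBall, mem_ofPred_eq, this, hGs r hr]
  congr

theorem volume_ellpNorm_nonpos (hn : n ≠ 0) (hp : 1 ≤ p) :
    volume {x : EuclideanSpace ℝ (Fin n) | ellpNorm p x ≤ 0} = 0 := by
  have : NeZero n := ⟨hn⟩
  have : Nontrivial (EuclideanSpace ℝ (Fin n)) := by
    apply Module.nontrivial_of_finrank_pos (R := ℝ)
    simpa using Nat.pos_of_ne_zero hn
  refine measure_mono_null (t := {0}) (fun x hx => ?_) (measure_singleton 0)
  exact eq_zero_of_ellpNorm_eq_zero hp (le_antisymm hx (ellpNorm_nonneg p x))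

/-- Polar decomposition: degree-zero homogeneous functions and functions of `ellpNorm` are
independent. -/
theorem volume_lpBall_mul_lintegral_mul_comp_ellpNorm (hn : n ≠ 0) (hp : 1 ≤ p)
    {G : EuclideanSpace ℝ (Fin n) → ℝ≥0∞} (hG : Measurable G)
    (hGs : ∀ r : ℝ, 0 < r → ∀ x, G (r • x) = G x) (hfin : ∫⁻ x in lpBall n p, G x ≠ ∞)
    {φ : ℝ → ℝ≥0∞} (hφ : Measurable φ) :
    volume (lpBall n p) * ∫⁻ x, G x * φ (ellpNorm p x) =
      (∫⁻ x in lpBall n p, G x) * ∫⁻ x : EuclideanSpace ℝ (Fin n), φ (ellpNorm p x) := by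
  have hN := measurable_ellpNorm n p
  have hV := (volume_lpBall_lt_top n hp).ne
  have hvol : ∀ r : ℝ, 0 < r → volume {x : EuclideanSpace ℝ (Fin n) | ellpNorm p x ≤ r} =
      ENNReal.ofReal (r ^ n) * volume (lpBall n p) := by
    intro r hr
    have := setLIntegral_sublevel_ellpNorm (n := n) hp hr (G := fun _ => 1) measurable_const
      fun _ _ _ => rfl
    simpa using this
  have hmap : ∀ r : ℝ, ((volume.withDensity G).map (ellpNorm p)) (Iic r) =
      ∫⁻ x in {x | ellpNorm p x ≤ r}, G x := by
    intro r
    rw [Measure.map_apply hN measurableSet_Iic, withDensity_apply _ (hN measurableSet_Iic)]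
    rfl
  have hmap' : ∀ r : ℝ, ((volume : Measure (EuclideanSpace ℝ (Fin n))).map (ellpNorm p)) (Iic r) =
      volume {x : EuclideanSpace ℝ (Fin n) | ellpNorm p x ≤ r} := by
    intro r
    rw [Measure.map_apply hN measurableSet_Iic]
    rfl
  -- The laws of the radius with and without the weight `G` both give `Iic r` mass proportional to
  -- `r ^ n`; half-lines determine the measure.
  have key : ∀ r : ℝ,
      (volume (lpBall n p) • (volume.withDensity G).map (ellpNorm p)) (Iic r) =
      ((∫⁻ x in lpBall n p, G x) •
        (volume : Measure (EuclideanSpace ℝ (Fin n))).map (ellpNorm p)) (Iic r) := by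
    intro r
    rw [Measure.smul_apply, Measure.smul_apply, hmap, hmap', smul_eq_mul, smul_eq_mul]
    rcases le_or_gt r 0 with hr | hr
    -- At `r = 0` the sublevel set is the origin, which is null because `n ≠ 0`.
    · have h0 : volume {x : EuclideanSpace ℝ (Fin n) | ellpNorm p x ≤ r} = 0 :=
        measure_mono_null (fun x hx => le_trans hx hr) (volume_ellpNorm_nonpos hn hp)
      rw [setLIntegral_measure_zero _ _ h0, h0, mul_zero, mul_zero]
    · rw [setLIntegral_sublevel_ellpNorm hp hr hG hGs, hvol r hr]
      ring
  have hμ : volume (lpBall n p) • (volume.withDensity G).map (ellpNorm p) =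
      (∫⁻ x in lpBall n p, G x) •
        (volume : Measure (EuclideanSpace ℝ (Fin n))).map (ellpNorm p) := by
    refine Measure.ext_of_generateFrom_of_iUnion (range Iic) (fun k : ℕ => Iic (k + 1 : ℝ))
      ((BorelSpace.measurable_eq (α := ℝ)).trans (borel_eq_generateFrom_Iic ℝ)) isPiSystem_Iic
      ?_ (fun k => mem_range_self _) (fun k => ?_) ?_
    · refine eq_univ_of_forall fun x => mem_iUnion.2 ?_
      obtain ⟨k, hk⟩ := exists_nat_ge x
      exact ⟨k, hk.trans (by simp)⟩
    · rw [key, Measure.smul_apply, hmap', hvol _ (by positivity)]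
      exact ENNReal.mul_ne_top hfin (ENNReal.mul_ne_top ENNReal.ofReal_ne_top hV)
    · rintro _ ⟨r, rfl⟩
      exact key r
  have := congrArg (fun μ => ∫⁻ s, φ s ∂μ) hμ
  simp only [lintegral_smul_measure, smul_eq_mul] at this
  rw [lintegral_map hφ hN, lintegral_map hφ hN,
    lintegral_withDensity_eq_lintegral_mul _ hG
    (g := fun x => φ (ellpNorm p x)) (hφ.comp hN)] at this
  exact this

/-- The mass of `exp (-‖x‖_p ^ p)` outside a ball of radius of order `n ^ (1 / p)`. -/
theorem lintegral_expNegSumRpow_le_two_mul (hn : n ≠ 0) (hp : 2 ≤ p) :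
    ∫⁻ x : EuclideanSpace ℝ (Fin n), expNegSumRpow p x ≤
      2 * ∫⁻ x in {x : EuclideanSpace ℝ (Fin n) |
        (2 * Real.exp 1)⁻¹ * (n : ℝ) ^ (1 / p) ≤ ellpNorm p x}, expNegSumRpow p x := by
  have hp1 : 1 ≤ p := by linarith
  set a := (2 * Real.exp 1)⁻¹ with ha
  have ha0 : 0 < a := by positivity
  set S := {x : EuclideanSpace ℝ (Fin n) | a * (n : ℝ) ^ (1 / p) ≤ ellpNorm p x} with hS
  have hSm : MeasurableSet S := measurableSet_le measurable_const (measurable_ellpNorm n p)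
  set E := ∫⁻ x : EuclideanSpace ℝ (Fin n), expNegSumRpow p x with hE
  have hEtop : E ≠ ∞ := by
    rw [hE, lintegral_expNegSumRpow]
    exact ENNReal.pow_ne_top (lintegral_expNegAbsRpow_lt_top hp).ne
  -- Substituting `a x` for `x` produces `a ^ n`. If `a x` lies outside `S` then `‖x‖_p ^ p ≤ n`, so
  -- the integrand is at most `1 ≤ e^n exp (-‖x‖_p ^ p)`. Since `a e = 1/2`, the total is at most
  -- `(1/2)^n E ≤ E/2`.
  have hcompl : ∫⁻ x in Sᶜ, expNegSumRpow p x ≤ ENNReal.ofReal (1 / 2) * E := by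
    rw [← lintegral_indicator hSm.compl, lintegral_eq_mul_lintegral_comp_smul ha0
      ((measurable_expNegSumRpow p).indicator hSm.compl)]
    calc _ ≤ ENNReal.ofReal (a ^ n) * ∫⁻ x : EuclideanSpace ℝ (Fin n),
          ENNReal.ofReal (Real.exp n) * expNegSumRpow p x := by
          gcongr with x
          by_cases hx : a • x ∈ Sᶜ
          · rw [indicator_of_mem hx, expNegSumRpow_eq hp1, expNegSumRpow_eq hp1,
              ← ENNReal.ofReal_mul (Real.exp_pos _).le, ← Real.exp_add]
            refine ENNReal.ofReal_le_ofReal (Real.exp_le_exp.2 ?_)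
            have h1 : ellpNorm p x < (n : ℝ) ^ (1 / p) := by
              have : ¬ a * (n : ℝ) ^ (1 / p) ≤ ellpNorm p (a • x) := hx
              rw [ellpNorm_smul hp1 ha0.le, mul_le_mul_iff_right₀ ha0] at this
              exact not_le.1 this
            have h2 : ellpNorm p x ^ p ≤ n := by
              have := Real.rpow_le_rpow (ellpNorm_nonneg p x) h1.le (by linarith : 0 ≤ p)
              rwa [← Real.rpow_mul (Nat.cast_nonneg n), one_div_mul_cancel (by linarith),
                Real.rpow_one] at this
            have h3 : 0 ≤ ellpNorm p (a • x) ^ p := Real.rpow_nonneg (ellpNorm_nonneg _ _) _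
            linarith
          · rw [indicator_of_notMem hx]
            exact zero_le
      _ = ENNReal.ofReal ((1 / 2) ^ n) * E := by
          rw [lintegral_const_mul _ (by fun_prop), ← mul_assoc,
            ← ENNReal.ofReal_mul (by positivity), ← Real.exp_one_pow, ← mul_pow, ha]
          congr 3
          field_simp
      _ ≤ _ := by
          gcongr
          exact pow_le_of_le_one (by norm_num) (by norm_num) hn
  have hsplit := lintegral_add_compl (μ := volume)
    (fun x : EuclideanSpace ℝ (Fin n) => expNegSumRpow p x) hSm
  have hhalf : ENNReal.ofReal (1 / 2) * E ≠ ∞ := ENNReal.mul_ne_top ENNReal.ofReal_ne_top hEtop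
  have hE2 : E = ENNReal.ofReal (1 / 2) * E + ENNReal.ofReal (1 / 2) * E := by
    rw [← add_mul, ← ENNReal.ofReal_add (by norm_num) (by norm_num)]
    norm_num
  have h1 : ENNReal.ofReal (1 / 2) * E ≤ ∫⁻ x in S, expNegSumRpow p x := by
    refine (ENNReal.add_le_add_iff_right hhalf).1 ?_
    calc _ = E := hE2.symm
      _ = (∫⁻ x in S, expNegSumRpow p x) + ∫⁻ x in Sᶜ, expNegSumRpow p x := hsplit.symm
      _ ≤ _ := by gcongr
  rw [hE2, two_mul]
  gcongr

/-- The cone measure is the image of normalized volume on the ball under radial projection. An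
inequality suffices and spares a discussion of the origin. -/
theorem lintegral_coneMeasure_le (hp : 1 ≤ p) {F : EuclideanSpace ℝ (Fin n) → ℝ≥0∞}
    (hF : Measurable F) :
    ∫⁻ x : lpSphere n p, F x ∂coneMeasure n p hp ≤
      (volume (lpBall n p))⁻¹ * ∫⁻ x in lpBall n p, F ((ellpNorm p x)⁻¹ • x) := by
  have hπ : Measurable fun x : EuclideanSpace ℝ (Fin n) => (ellpNorm p x)⁻¹ • x :=
    (measurable_ellpNorm n p).inv.smul measurable_id
  have hle : (coneMeasure n p hp).map ((↑) : lpSphere n p → EuclideanSpace ℝ (Fin n)) ≤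
      (volume (lpBall n p))⁻¹ •
        (volume.restrict (lpBall n p)).map fun x => (ellpNorm p x)⁻¹ • x := by
    refine Measure.le_iff.2 fun A hA => ?_
    have hA' : MeasurableSet ((↑) ⁻¹' A : Set (lpSphere n p)) := measurable_subtype_coe hA
    rw [Measure.map_apply measurable_subtype_coe hA, Measure.smul_apply,
      Measure.map_apply hπ hA, Measure.restrict_apply (hπ hA), smul_eq_mul, coneMeasure,
      Measure.ofMeasurable_apply _ hA', volume_coneOver hp, div_eq_mul_inv, mul_comm]
    gcongr
    rintro y ⟨hy1, z, hz, hzy⟩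
    exact ⟨by simpa [← hzy] using hz, hy1⟩
  calc _ = ∫⁻ x, F x ∂((coneMeasure n p hp).map (↑)) :=
        (lintegral_map hF measurable_subtype_coe).symm
    _ ≤ _ := lintegral_mono' hle le_rfl
    _ = _ := by rw [lintegral_smul_measure, lintegral_map hF hπ, smul_eq_mul]

end Norm

/-! ### Transfer to the sphere. -/

theorem exists_lintegral_psiTwo_coneMeasure_le_one :
    ∃ l : ℝ, 0 < l ∧ ∀ (p : ℝ) (hp : 2 ≤ p) (n : ℕ) (θ : EuclideanSpace ℝ (Fin n)), ‖θ‖ = 1 →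
      ∫⁻ x : lpSphere n p, ENNReal.ofReal (psiTwo
        (|(n : ℝ) ^ (1 / p) * inner ℝ (x : EuclideanSpace ℝ (Fin n)) θ| / l))
        ∂coneMeasure n p (one_le_two.trans hp) ≤ 1 := by
  obtain ⟨b, M, hb, hM, h⟩ := exists_lintegral_exp_inner_sq_le
  -- In `2 d M` the `2` pays for restricting to half of the mass, and `d` is the convexity factor.
  obtain ⟨d, hd0, hd1, hdM⟩ : ∃ d : ℝ, 0 < d ∧ d ≤ 1 ∧ 2 * d * M ≤ 1 := by
    refine ⟨1 / (1 + 2 * M), by positivity, ?_, ?_⟩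
    · rw [div_le_one (by positivity)]
      linarith
    · rw [mul_comm 2, mul_assoc, div_mul_eq_mul_div, div_le_one (by positivity)]
      linarith
  set a := (2 * Real.exp 1)⁻¹ with ha
  have ha0 : 0 < a := by positivity
  -- Chosen so that on `‖x‖_p ≥ a R` the exponent of `ψ₂` is at most `d b ⟨x, θ⟩²`.
  set l := (a * Real.sqrt (d * b))⁻¹ with hl
  have hl0 : 0 < l := by positivity
  have hal : (1 / l) ^ 2 = a ^ 2 * (d * b) := by
    rw [hl, one_div, inv_inv, mul_pow, Real.sq_sqrt (by positivity)]
  refine ⟨l, hl0, fun p hp n θ hθ => ?_⟩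
  have hp1 : 1 ≤ p := by linarith
  rcases eq_or_ne n 0 with rfl | hn
  · have : θ = 0 := Subsingleton.elim _ _
    simp [this] at hθ
  set R := (n : ℝ) ^ (1 / p) with hR
  have hR0 : 0 < R := Real.rpow_pos_of_pos (Nat.cast_pos.2 (Nat.pos_of_ne_zero hn)) _
  set F : EuclideanSpace ℝ (Fin n) → ℝ≥0∞ := fun x =>
    ENNReal.ofReal (psiTwo (|R * inner ℝ x θ| / l)) with hF
  have hFm : Measurable F := by
    simp only [hF, psiTwo]
    fun_prop
  set G : EuclideanSpace ℝ (Fin n) → ℝ≥0∞ := fun x => F ((ellpNorm p x)⁻¹ • x) with hG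
  have hGm : Measurable G :=
    hFm.comp ((measurable_ellpNorm n p).inv.smul measurable_id)
  have hGs : ∀ r : ℝ, 0 < r → ∀ x, G (r • x) = G x := by
    intro r hr x
    simp only [hG]
    rw [ellpNorm_smul hp1 hr.le, smul_smul, mul_inv, mul_right_comm, inv_mul_cancel₀ hr.ne',
      one_mul]
  have hGexp : ∀ x, G x = ENNReal.ofReal
      (Real.exp (R ^ 2 * (a ^ 2 * (d * b)) * ((ellpNorm p x)⁻¹ * inner ℝ x θ) ^ 2) - 1) := by
    intro x
    simp only [hG, hF, psiTwo]
    rw [div_pow, sq_abs, real_inner_smul_left, ← hal]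
    congr 3
    ring
  -- This bound depends on `n` and only ensures that `A` is finite, as the polar decomposition
  -- requires.
  have hGbdd : ∀ x, G x ≤ ENNReal.ofReal (Real.exp (R ^ 2 * (a ^ 2 * (d * b)) * n)) := by
    intro x
    rw [hGexp]
    refine ENNReal.ofReal_le_ofReal ((sub_le_self _ zero_le_one).trans (Real.exp_le_exp.2 ?_))
    gcongr
    have h1 : (inner ℝ x θ) ^ 2 ≤ ‖x‖ ^ 2 := by
      rw [← sq_abs]
      gcongr
      simpa [hθ] using abs_real_inner_le_norm x θ
    have h2 := norm_sq_le_mul_ellpNorm_sq hp1 x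
    rw [mul_pow, inv_pow]
    rcases (ellpNorm_nonneg p x).eq_or_lt with h0 | h0
    · simp [← h0]
    · rw [inv_mul_le_iff₀ (by positivity)]
      linarith
  have hV := volume_lpBall_lt_top n hp1
  set A := ∫⁻ x in lpBall n p, G x with hA
  have hfin : A ≠ ∞ := by
    refine ((setLIntegral_mono measurable_const fun x _ => hGbdd x).trans_lt ?_).ne
    rw [setLIntegral_const]
    exact ENNReal.mul_lt_top ENNReal.ofReal_lt_top hV
  set E := ∫⁻ x : EuclideanSpace ℝ (Fin n), expNegSumRpow p x with hE
  have hEtop : E ≠ ∞ := by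
    rw [hE, lintegral_expNegSumRpow]
    exact ENNReal.pow_ne_top (lintegral_expNegAbsRpow_lt_top hp).ne
  have hE0 : E ≠ 0 := by
    rw [hE, lintegral_expNegSumRpow]
    refine pow_ne_zero _ fun h0 => ?_
    have := one_le_exp_mul_lintegral_expNegAbsRpow (p := p) (by linarith)
    simp [h0] at this
  -- The radial density is cut off to large radii, where dividing by the norm is harmless.
  set φ : ℝ → ℝ≥0∞ := (Ici (a * R)).indicator fun s => ENNReal.ofReal (Real.exp (-s ^ p)) with hφ
  have hφm : Measurable φ := Measurable.indicator (by fun_prop) measurableSet_Ici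
  have hSm : MeasurableSet {x : EuclideanSpace ℝ (Fin n) | a * R ≤ ellpNorm p x} :=
    measurableSet_le measurable_const (measurable_ellpNorm n p)
  have hφx : ∀ x : EuclideanSpace ℝ (Fin n), φ (ellpNorm p x) =
      {x : EuclideanSpace ℝ (Fin n) | a * R ≤ ellpNorm p x}.indicator (expNegSumRpow p) x := by
    intro x
    simp only [hφ, indicator, mem_Ici, mem_ofPred_eq, expNegSumRpow_eq hp1]
  have hrad := volume_lpBall_mul_lintegral_mul_comp_ellpNorm hn hp1 hGm hGs hfin hφm
  have hD : E ≤ 2 * ∫⁻ x : EuclideanSpace ℝ (Fin n), φ (ellpNorm p x) := by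
    simp only [hφx]
    rw [lintegral_indicator hSm]
    exact lintegral_expNegSumRpow_le_two_mul hn hp
  have hup : ∫⁻ x, G x * φ (ellpNorm p x) ≤ ENNReal.ofReal (d * M) * E := by
    calc _ ≤ ∫⁻ x : EuclideanSpace ℝ (Fin n), ENNReal.ofReal d *
          (ENNReal.ofReal (Real.exp (b * (inner ℝ x θ) ^ 2)) * expNegSumRpow p x) := by
          refine lintegral_mono fun x => ?_
          rw [hφx]
          by_cases hx : x ∈ {x : EuclideanSpace ℝ (Fin n) | a * R ≤ ellpNorm p x}
          · rw [indicator_of_mem hx, ← mul_assoc, ← ENNReal.ofReal_mul hd0.le, hGexp]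
            gcongr
            have hN : 0 < ellpNorm p x := lt_of_lt_of_le (by positivity) hx
            have h1 : R ^ 2 * (a ^ 2 * (d * b)) * ((ellpNorm p x)⁻¹ * inner ℝ x θ) ^ 2 ≤
                d * (b * (inner ℝ x θ) ^ 2) := by
              have h2 : a * R * (ellpNorm p x)⁻¹ ≤ 1 := by
                rw [← div_eq_mul_inv]
                exact (div_le_one hN).2 hx
              have h3 : (a * R * (ellpNorm p x)⁻¹) ^ 2 ≤ 1 := pow_le_one₀ (by positivity) h2
              calc _ = (a * R * (ellpNorm p x)⁻¹) ^ 2 * (d * (b * (inner ℝ x θ) ^ 2)) := by ring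
                _ ≤ 1 * (d * (b * (inner ℝ x θ) ^ 2)) := by gcongr
                _ = _ := one_mul _
            have h4 := Real.exp_le_exp.2 h1
            have h5 := exp_mul_sub_one_le (s := b * (inner ℝ x θ) ^ 2) hd0.le hd1
            linarith
          · rw [indicator_of_notMem hx, mul_zero]
            exact zero_le
      _ ≤ ENNReal.ofReal d * (ENNReal.ofReal M * E) := by
          rw [lintegral_const_mul _ (by fun_prop)]
          gcongr
          exact h p hp n θ hθ
      _ = _ := by rw [ENNReal.ofReal_mul hd0.le, mul_assoc]
  -- Independence gives `A E ≤ 2 d M · vol · E`; cancelling `E` uses that it is neither `0` nor `∞`.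
  have hAV : A ≤ volume (lpBall n p) := by
    refine (ENNReal.mul_le_mul_iff_left hE0 hEtop).1 ?_
    calc A * E ≤ A * (2 * ∫⁻ x : EuclideanSpace ℝ (Fin n), φ (ellpNorm p x)) := by gcongr
      _ = 2 * (volume (lpBall n p) * ∫⁻ x, G x * φ (ellpNorm p x)) := by rw [hrad]; ring
      _ ≤ 2 * (volume (lpBall n p) * (ENNReal.ofReal (d * M) * E)) := by gcongr
      _ = ENNReal.ofReal (2 * d * M) * (volume (lpBall n p) * E) := by
          rw [mul_assoc, ENNReal.ofReal_mul zero_le_two, ENNReal.ofReal_ofNat]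
          ring
      _ ≤ 1 * (volume (lpBall n p) * E) := by
          gcongr
          exact ENNReal.ofReal_le_one.2 hdM
      _ = _ := one_mul _
  calc _ ≤ (volume (lpBall n p))⁻¹ * A := lintegral_coneMeasure_le hp1 hFm
    _ ≤ (volume (lpBall n p))⁻¹ * volume (lpBall n p) := by gcongr
    _ ≤ 1 := ENNReal.inv_mul_le_one _

theorem mainTheorem4 :
    ∃ c : ℝ, 0 < c ∧ ∀ (p : ℝ) (hp : 2 ≤ p) (n : ℕ) (θ : EuclideanSpace ℝ (Fin n)),
      θ ∈ Metric.sphere (0 : EuclideanSpace ℝ (Fin n)) 1 →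
      MemOrlicz psiTwo (fun x : lpSphere n p => (n : ℝ) ^ (1 / p) * inner ℝ (x : EuclideanSpace ℝ (Fin n)) θ)
          (coneMeasure n p (one_le_two.trans hp)) ∧
        luxemburgNorm psiTwo
          (fun x : lpSphere n p => (n : ℝ) ^ (1 / p) * inner ℝ (x : EuclideanSpace ℝ (Fin n)) θ)
          (coneMeasure n p (one_le_two.trans hp)) ≤ ENNReal.ofReal c := by
  obtain ⟨l, hl, h⟩ := exists_lintegral_psiTwo_coneMeasure_le_one
  refine ⟨l, hl, fun p hp n θ hθ => ?_⟩
  have hle := h p hp n θ (mem_sphere_zero_iff_norm.1 hθ)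
  refine ⟨⟨?_, l, hl, hle.trans_lt ENNReal.one_lt_top⟩, sInf_le ⟨l, hl, hle, rfl⟩⟩
  have : Measurable fun x : EuclideanSpace ℝ (Fin n) => (n : ℝ) ^ (1 / p) * inner ℝ x θ := by
    fun_prop
  exact (this.comp measurable_subtype_coe).aemeasurable
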